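/- Let $n\in\mathbb N$, $\alpha\in(0,1)$, $1<p<n/\alpha$, $1\le q<\infty$, and let $\nu$ be a nonnegative outer measure on $\mathbb R^{1+n}_+=(0,\infty)\times\mathbb R^n$ (defined on all subsets, with values in $[0,\infty]$, monotone, countably subadditive, $\nu(\emptyset)=0$). For $f:\mathbb R^n\to\mathbb R$ put $$\|f\|_{\dot\Lambda^{p,\infty}_\alpha}=\sup_{h\ne 0}|h|^{-\alpha}\|f(\cdot+h)-f\|_{L^p(\mathbb R^n)},$$ and let $\Lambda^{p,\infty}_\alpha$ be the class of all $f\in L^p(\mathbb R^n)$ with $\|f\|_{\dot\Lambda^{p,\infty}_\alpha}<\infty$. For $E\subset\mathbb R^n$ let $$C_{\alpha,p,\infty}(E)=\inf\big\{\|f\|^p_{\dot\Lambda^{p,\infty}_\alpha}: f\in\Lambda^{p,\infty}_\alpha\cap C(\mathbb R^n),\ f\ge 1\text{ on a neighbourhood of }E\big\}\qquad(\inf\emptyset=\infty).$$ For $f\in\Lambda^{p,\infty}_\alpha\cap C(\mathbb R^n)$ let $$w(t,x)=(4\pi t)^{-n/2}\int_{\mathbb R^n}\exp\Big(-\frac{|x-y|^2}{4t}\Big)f(y)\,dy\qquad((t,x)\in\mathbb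 R^{1+n}_+)$$ be its heat extension, and for open $O\subset\mathbb R^n$ let $T(O)=\{(t,x)\in\mathbb R^{1+n}_+: B(x,t)\subseteq O\}$ be the tent over $O$, where $B(x,t)$ is the open Euclidean ball. Then the following are equivalent: (a) there is a constant $0<C<\infty$ such that for all $f\in\Lambda^{p,\infty}_\alpha\cap C(\mathbb R^n)$ $$\sup_{\lambda>0}\Big(\lambda^q\,\nu\big(\{(t,x)\in\mathbb R^{1+n}_+: |w(t^2,x)|>\lambda\}\big)\Big)^{1/q}\le C\,\|f\|_{\dot\Lambda^{p,\infty}_\alpha};$$ (b) there is a constant $0<C<\infty$ such that $\nu(T(O))\le C\,\big(C_{\alpha,p,\infty}(O)\big)^{q/p}$ for every open $O\subset\mathbb R^n$. -/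

import Mathlib

open MeasureTheory Filter Topology
open scoped ENNReal NNReal

noncomputable section

/-- The open upper half-space `(0, ∞) × ℝⁿ`. -/
abbrev UpperHalfSpace (n : ℕ) : Type :=
  Set.Ioi (0 : ℝ) × EuclideanSpace ℝ (Fin n)

/-- The homogeneous `∞`-Besov seminorm `sup_h ‖f(· + h) - f‖_{L^p} |h|^{-α}`, with values in
`[0, ∞]`; the term `h = 0`, which is void because the difference vanishes, is left out. -/
def besovSeminorm {n : ℕ} (α : ℝ) (p : ℝ≥0∞) (f : EuclideanSpace ℝ (Fin n) → ℝ) : ℝ≥0∞ :=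
  ⨆ (h : EuclideanSpace ℝ (Fin n)) (_ : h ≠ 0),
    eLpNorm (fun x => f (x + h) - f x) p volume / ENNReal.ofReal (‖h‖ ^ α)

/-- The continuous representatives in the `∞`-Besov space: continuous functions which lie in
`L^p` and have finite `∞`-Besov seminorm. -/
def continuousBesov (n : ℕ) (α : ℝ) (p : ℝ≥0∞) : Set (EuclideanSpace ℝ (Fin n) → ℝ) :=
  {f | Continuous f ∧ MemLp f p volume ∧ besovSeminorm α p f < ∞}

/-- The functions admissible for the capacity of `E`: the continuous functions in the `∞`-Besov
space which are at least `1` on some neighbourhood of `E`. -/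
def besovAdmissible {n : ℕ} (α : ℝ) (p : ℝ≥0∞) (E : Set (EuclideanSpace ℝ (Fin n))) :
    Set (EuclideanSpace ℝ (Fin n) → ℝ) :=
  {f | f ∈ continuousBesov n α p ∧ ∃ N ∈ 𝓝ˢ E, ∀ x ∈ N, 1 ≤ f x}

/-- The homogeneous `∞`-Besov capacity of `E`; it is `∞` if no function is admissible. -/
def besovCapacity {n : ℕ} (α p : ℝ) (E : Set (EuclideanSpace ℝ (Fin n))) : ℝ≥0∞ :=
  ⨅ f ∈ besovAdmissible α (ENNReal.ofReal p) E, besovSeminorm α (ENNReal.ofReal p) f ^ p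

/-- The heat extension `w(t, x)` of `f`: convolution with the Gauss-Weierstrass kernel. -/
def heatExtension {n : ℕ} (f : EuclideanSpace ℝ (Fin n) → ℝ) (t : ℝ)
    (x : EuclideanSpace ℝ (Fin n)) : ℝ :=
  (4 * Real.pi * t) ^ (-(n : ℝ) / 2) * ∫ y, Real.exp (-(‖x - y‖ ^ 2) / (4 * t)) * f y

/-- The tent over `O`: the points `(t, x)` of the upper half-space with `B(x, t) ⊆ O`. -/
def tent {n : ℕ} (O : Set (EuclideanSpace ℝ (Fin n))) : Set (UpperHalfSpace n) :=
  {z | Metric.ball z.2 (z.1 : ℝ) ⊆ O}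

end

/-! Both directions compare heat superlevel sets with tents, one level λ at a time, so no
strong-type capacitary inequality is needed.

(a) ⇒ (b): if f is admissible for O and B(x,t) ⊆ O, then |f| ≥ 1 on B(x,t), and the Gaussian at time
t² puts at least a fixed mass κ on that ball (`exists_le_heatExtension`). So T(O) lies in a
superlevel set of the extension of |f|; apply (a) and take the infimum over f.

(b) ⇒ (a): let M be the centred maximal operator. Then |w(t²,x)| ≤ θ Mf(y) for every y in B(x,t)
(`exists_lintegral_heatKernel_le_hlMaximal`), so {|w| > λ} lies in T(O) with O = {θ Mf > λ}. The
function θ Mf/λ is itself admissible for O: Mf is continuous, and M is bounded on the Besov class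
(`exists_besov_hlMaximal`), because it is sublinear, commutes with translations and is bounded on
L^p for p > 1. Hence the capacity of O is at most (θA‖f‖/λ)^p, and (b) gives (a). -/

/-! ### The centred maximal operator: sublinearity, translations, semicontinuity. -/

section MaximalFunction

variable {E : Type*} [NormedAddCommGroup E] [MeasurableSpace E]

/-- The centred Hardy-Littlewood maximal function of a function with values in `[0, ∞]`. -/
noncomputable def hlMaximal (μ : Measure E) (u : E → ℝ≥0∞) (x : E) : ℝ≥0∞ :=
  ⨆ (r : ℝ) (_ : 0 < r), (∫⁻ y in Metric.ball x r, u y ∂μ) / μ (Metric.ball x r)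

theorem lt_hlMaximal_iff {μ : Measure E} {u : E → ℝ≥0∞} {x : E} {a : ℝ≥0∞} :
    a < hlMaximal μ u x ↔
      ∃ r : ℝ, 0 < r ∧ a < (∫⁻ y in Metric.ball x r, u y ∂μ) / μ (Metric.ball x r) := by
  simp only [hlMaximal, lt_iSup_iff, exists_prop]

theorem hlMaximal_le_iff {μ : Measure E} {u : E → ℝ≥0∞} {x : E} {a : ℝ≥0∞} :
    hlMaximal μ u x ≤ a ↔
      ∀ r : ℝ, 0 < r → (∫⁻ y in Metric.ball x r, u y ∂μ) / μ (Metric.ball x r) ≤ a := by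
  simp only [hlMaximal, iSup_le_iff]

theorem laverage_ball_le_hlMaximal (μ : Measure E) (u : E → ℝ≥0∞) (x : E) {r : ℝ} (hr : 0 < r) :
    (∫⁻ y in Metric.ball x r, u y ∂μ) / μ (Metric.ball x r) ≤ hlMaximal μ u x :=
  hlMaximal_le_iff.1 le_rfl r hr

theorem hlMaximal_mono {μ : Measure E} {u v : E → ℝ≥0∞} (h : ∀ x, u x ≤ v x) (x : E) :
    hlMaximal μ u x ≤ hlMaximal μ v x :=
  hlMaximal_le_iff.2 fun _ hr =>
    (ENNReal.div_le_div_right (lintegral_mono h) _).trans (laverage_ball_le_hlMaximal μ v x hr)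

theorem hlMaximal_add_le {μ : Measure E} {u v : E → ℝ≥0∞} (hu : Measurable u) (x : E) :
    hlMaximal μ (fun y => u y + v y) x ≤ hlMaximal μ u x + hlMaximal μ v x :=
  hlMaximal_le_iff.2 fun r hr => by
    rw [lintegral_add_left hu, ENNReal.add_div]
    exact add_le_add (laverage_ball_le_hlMaximal μ u x hr) (laverage_ball_le_hlMaximal μ v x hr)

theorem hlMaximal_const_le (μ : Measure E) (c : ℝ≥0∞) (x : E) :
    hlMaximal μ (fun _ => c) x ≤ c :=
  hlMaximal_le_iff.2 fun r _ => by
    rw [setLIntegral_const, mul_div_assoc]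
    exact mul_le_of_le_one_right' ENNReal.div_self_le_one

/-- An open ball is the increasing union of smaller concentric ones. The slack r - s lets the centre
move in `isOpen_lt_hlMaximal`. -/
theorem exists_lt_setLIntegral_ball {μ : Measure E} {u : E → ℝ≥0∞} {x : E} {r : ℝ}
    {a : ℝ≥0∞} (h : a < ∫⁻ y in Metric.ball x r, u y ∂μ) :
    ∃ s < r, a < ∫⁻ y in Metric.ball x s, u y ∂μ := by
  have hmono : Monotone fun k : ℕ => Metric.ball x (r - 1 / ((k : ℝ) + 1)) := fun k l hkl =>
    Metric.ball_subset_ball (sub_le_sub_left (Nat.one_div_le_one_div hkl) r)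
  have hU : Metric.ball x r = ⋃ k : ℕ, Metric.ball x (r - 1 / ((k : ℝ) + 1)) := by
    ext y
    simp only [Set.mem_iUnion, Metric.mem_ball]
    constructor
    · intro hy
      obtain ⟨k, hk⟩ := exists_nat_one_div_lt (sub_pos.2 hy)
      exact ⟨k, by linarith⟩
    · rintro ⟨k, hk⟩
      have : 0 < 1 / ((k : ℝ) + 1) := Nat.one_div_pos_of_nat
      linarith
  rw [hU, setLIntegral_iUnion_of_directed u hmono.directed_le] at h
  obtain ⟨k, hk⟩ := lt_iSup_iff.1 h
  exact ⟨_, sub_lt_self r Nat.one_div_pos_of_nat, hk⟩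

variable [BorelSpace E]

theorem hlMaximal_comp_add_right (μ : Measure E) [μ.IsAddHaarMeasure] (u : E → ℝ≥0∞) (h x : E) :
    hlMaximal μ (fun y => u (y + h)) x = hlMaximal μ u (x + h) := by
  refine iSup_congr fun r => iSup_congr fun _ => ?_
  have hmp := measurePreserving_add_right μ h
  have hpre : (fun y => y + h) ⁻¹' Metric.ball (x + h) r = Metric.ball x r := by
    ext y; simp [dist_eq_norm]
  rw [← hpre, hmp.setLIntegral_comp_preimage_emb (measurableEmbedding_addRight h), hpre,
    Measure.addHaar_ball_center μ x, Measure.addHaar_ball_center μ (x + h)]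

theorem isOpen_lt_hlMaximal (μ : Measure E) [μ.IsAddHaarMeasure] [ProperSpace E]
    (u : E → ℝ≥0∞) (a : ℝ≥0∞) :
    IsOpen {x | a < hlMaximal μ u x} := by
  rw [Metric.isOpen_iff]
  intro x hx
  obtain ⟨r, hr, hx⟩ := lt_hlMaximal_iff.1 hx
  obtain ⟨s, hsr, hs⟩ := exists_lt_setLIntegral_ball
    ((ENNReal.lt_div_iff_mul_lt (Or.inl (Metric.measure_ball_pos μ x hr).ne')
      (Or.inl measure_ball_lt_top.ne)).1 hx)
  refine ⟨r - s, sub_pos.2 hsr, fun y hy => lt_hlMaximal_iff.2 ⟨r, hr, ?_⟩⟩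
  rw [ENNReal.lt_div_iff_mul_lt (Or.inl (Metric.measure_ball_pos μ y hr).ne')
      (Or.inl measure_ball_lt_top.ne), Measure.addHaar_ball_center μ y,
      ← Measure.addHaar_ball_center μ x]
  refine hs.trans_le (lintegral_mono_set (Metric.ball_subset_ball' ?_))
  have := Metric.mem_ball'.1 hy
  linarith

theorem measurable_hlMaximal (μ : Measure E) [μ.IsAddHaarMeasure] [ProperSpace E]
    (u : E → ℝ≥0∞) : Measurable (hlMaximal μ u) :=
  measurable_of_Ioi fun a => (isOpen_lt_hlMaximal μ u a).measurableSet

/-! ### Weak type (1,1) and strong type (p,p) bounds. -/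

section FiniteDimensional

variable [NormedSpace ℝ E] [FiniteDimensional ℝ E] [Nontrivial E]

/-- The weak type `(1, 1)` inequality. -/
theorem measure_lt_hlMaximal_mul_le (μ : Measure E) [μ.IsAddHaarMeasure] (u : E → ℝ≥0∞)
    {a : ℝ≥0∞} (ha : a ≠ ∞) :
    a * μ {x | a < hlMaximal μ u x} ≤ 4 ^ Module.finrank ℝ E * ∫⁻ x, u x ∂μ := by
  rcases eq_or_ne a 0 with rfl | ha0
  · simp
  rcases eq_or_ne (∫⁻ x, u x ∂μ) ∞ with hI | hI
  · rw [hI, ENNReal.mul_top (by positivity)]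
    exact le_top
  set d := Module.finrank ℝ E with hd
  have hd0 : d ≠ 0 := Module.finrank_pos.ne'
  set S := {x | a < hlMaximal μ u x} with hS
  have hV0 : μ (Metric.ball (0 : E) 1) ≠ 0 := (Metric.measure_ball_pos μ 0 one_pos).ne'
  have hVt : μ (Metric.ball (0 : E) 1) ≠ ∞ := measure_ball_lt_top.ne
  have key : ∀ x ∈ S, ∃ r : ℝ, 0 < r ∧
      a * μ (Metric.ball x r) < ∫⁻ y in Metric.ball x r, u y ∂μ := by
    intro x hx
    obtain ⟨r, hr, h⟩ := lt_hlMaximal_iff.1 hx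
    exact ⟨r, hr, (ENNReal.lt_div_iff_mul_lt (Or.inl (Metric.measure_ball_pos μ x hr).ne')
      (Or.inl measure_ball_lt_top.ne)).1 h⟩
  choose! r hr0 hr using key
  set B : ℝ≥0∞ := (∫⁻ x, u x ∂μ) / (a * μ (Metric.ball (0 : E) 1)) with hB
  have hBt : B ≠ ∞ := ENNReal.div_ne_top hI (mul_ne_zero ha0 hV0)
  -- Vitali's lemma needs bounded radii: the finite integral bounds r^d, and r ≤ r^d once r ≥ 1.
  have hbound : ∀ x ∈ S, r x ≤ max 1 B.toReal := by
    intro x hx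
    rcases le_total (r x) 1 with h1 | h1
    · exact h1.trans (le_max_left _ _)
    · refine le_trans ?_ (le_max_right _ _)
      refine (le_self_pow₀ h1 hd0).trans ?_
      rw [← ENNReal.ofReal_le_iff_le_toReal hBt, hB,
        ENNReal.le_div_iff_mul_le (Or.inl (mul_ne_zero ha0 hV0))
          (Or.inl (ENNReal.mul_ne_top ha hVt))]
      calc ENNReal.ofReal (r x ^ d) * (a * μ (Metric.ball 0 1))
          = a * μ (Metric.ball x (r x)) := by
            rw [Measure.addHaar_ball μ x (hr0 x hx).le]; ring
        _ ≤ ∫⁻ x, u x ∂μ := (hr x hx).le.trans (setLIntegral_le_lintegral _ _)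
  -- Any enlargement factor above 3 works; 4 produces the constant 4^d.
  obtain ⟨T, hTS, hdisj, hcov⟩ := Vitali.exists_disjoint_subfamily_covering_enlargement_closedBall
    S id r _ hbound 4 (by norm_num)
  have hdisj' : T.PairwiseDisjoint fun x => Metric.ball x (r x) := fun x hx y hy hxy =>
    (hdisj hx hy hxy).mono Metric.ball_subset_closedBall Metric.ball_subset_closedBall
  have hcount : T.Countable := hdisj'.countable_of_isOpen (fun _ _ => Metric.isOpen_ball)
    fun x hx => ⟨x, Metric.mem_ball_self (hr0 x (hTS hx))⟩
  have hsub : S ⊆ ⋃ x ∈ T, Metric.closedBall x (4 * r x) := by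
    intro x hx
    obtain ⟨y, hy, hxy⟩ := hcov x hx
    exact Set.mem_biUnion hy (hxy (Metric.mem_closedBall_self (hr0 x hx).le))
  calc a * μ S ≤ a * ∑' x : T, μ (Metric.closedBall (x : E) (4 * r x)) := by
        gcongr
        exact (measure_mono hsub).trans (measure_biUnion_le μ hcount _)
    _ = ∑' x : T, 4 ^ d * (a * μ (Metric.ball (x : E) (r x))) := by
        rw [← ENNReal.tsum_mul_left]
        refine tsum_congr fun x => ?_
        have h0 := (hr0 x (hTS x.2)).le
        rw [Measure.addHaar_closedBall μ _ (by positivity), Measure.addHaar_ball μ _ h0, mul_pow,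
          ENNReal.ofReal_mul (by positivity), ENNReal.ofReal_pow (by norm_num)]
        simp only [ENNReal.ofReal_ofNat]
        ring
    _ ≤ ∑' x : T, 4 ^ d * ∫⁻ y in Metric.ball (x : E) (r x), u y ∂μ :=
        ENNReal.tsum_le_tsum fun x => by gcongr; exact (hr x (hTS x.2)).le
    _ = 4 ^ d * ∫⁻ y in ⋃ x ∈ T, Metric.ball x (r x), u y ∂μ := by
        rw [ENNReal.tsum_mul_left,
          lintegral_biUnion hcount (fun _ _ => Metric.isOpen_ball.measurableSet) hdisj']
    _ ≤ 4 ^ d * ∫⁻ x, u x ∂μ := by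
        gcongr
        exact Measure.restrict_le_self

/-- Truncate at height a: u is at most its part above a plus the constant a. The constant adds at
most a to the maximal function, so the weak-type bound applies to the large part alone. -/
theorem mul_measure_lt_hlMaximal_le_setLIntegral (μ : Measure E) [μ.IsAddHaarMeasure]
    {u : E → ℝ≥0∞} (hu : Measurable u) {a : ℝ≥0∞} (ha : a ≠ ∞) :
    a * μ {x | 2 * a < hlMaximal μ u x} ≤
      4 ^ Module.finrank ℝ E * ∫⁻ x in {x | a < u x}, u x ∂μ := by
  have hm : MeasurableSet {x | a < u x} := measurableSet_lt measurable_const hu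
  rw [← lintegral_indicator hm]
  refine le_trans ?_ (measure_lt_hlMaximal_mul_le μ _ ha)
  gcongr a * μ ?_
  intro x hx
  by_contra hcon
  replace hx : 2 * a < hlMaximal μ u x := hx
  refine not_le.2 hx ?_
  calc hlMaximal μ u x
      ≤ hlMaximal μ (fun y => {x | a < u x}.indicator u y + a) x := by
        refine hlMaximal_mono (fun y => ?_) x
        by_cases hy : a < u y
        · rw [Set.indicator_of_mem (by exact hy)]; exact le_self_add
        · exact (not_lt.1 hy).trans le_add_self
    _ ≤ hlMaximal μ ({x | a < u x}.indicator u) x + hlMaximal μ (fun _ => a) x :=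
        hlMaximal_add_le (hu.indicator hm) x
    _ ≤ a + a := add_le_add (not_lt.1 hcon) (hlMaximal_const_le μ a x)
    _ = 2 * a := (two_mul a).symm

/-- The Hardy-Littlewood maximal inequality in `L^p` for `1 < p`. -/
theorem lintegral_hlMaximal_rpow_le (μ : Measure E) [μ.IsAddHaarMeasure] {p : ℝ} (hp : 1 < p)
    {u : E → ℝ≥0∞} (hu : Measurable u) (hut : ∀ x, u x ≠ ∞) (hMt : ∀ x, hlMaximal μ u x ≠ ∞) :
    ∫⁻ x, hlMaximal μ u x ^ p ∂μ ≤
      ENNReal.ofReal (p / (p - 1) * 2 ^ p) * 4 ^ Module.finrank ℝ E * ∫⁻ x, u x ^ p ∂μ := by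
  have hp0 : 0 < p := one_pos.trans hp
  have hp1 : 0 < p - 1 := sub_pos.2 hp
  set K : ℝ≥0∞ := 4 ^ Module.finrank ℝ E
  have hlhs : ∫⁻ x, hlMaximal μ u x ^ p ∂μ = ENNReal.ofReal p * ∫⁻ t in Set.Ioi (0 : ℝ),
      μ {x | t < (hlMaximal μ u x).toReal} * ENNReal.ofReal (t ^ (p - 1)) := by
    rw [← lintegral_rpow_eq_lintegral_meas_lt_mul μ (ae_of_all _ fun _ => ENNReal.toReal_nonneg)
      (measurable_hlMaximal μ u).ennreal_toReal.aemeasurable hp0]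
    refine lintegral_congr fun x => ?_
    rw [← ENNReal.ofReal_rpow_of_nonneg ENNReal.toReal_nonneg hp0.le, ENNReal.ofReal_toReal (hMt x)]
  -- Layer cake for 2u with exponent p - 1 under the measure u dμ; this replaces Fubini in the
  -- Marcinkiewicz argument.
  have hrhs : ENNReal.ofReal (2 ^ (p - 1)) * ∫⁻ x, u x ^ p ∂μ =
      ENNReal.ofReal (p - 1) * ∫⁻ t in Set.Ioi (0 : ℝ),
        (∫⁻ x in {x | t < 2 * (u x).toReal}, u x ∂μ) * ENNReal.ofReal (t ^ (p - 1 - 1)) := by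
    have hset : ∀ t : ℝ, MeasurableSet {x | t < 2 * (u x).toReal} := fun t =>
      measurableSet_lt measurable_const (hu.ennreal_toReal.const_mul 2)
    have := lintegral_rpow_eq_lintegral_meas_lt_mul (μ.withDensity u)
      (f := fun x => 2 * (u x).toReal) (ae_of_all _ fun x => by positivity)
      (hu.ennreal_toReal.const_mul 2).aemeasurable hp1
    simp only [withDensity_apply u (hset _)] at this
    rw [← this, lintegral_withDensity_eq_lintegral_mul μ hu (by fun_prop),
      ← lintegral_const_mul _ (by fun_prop)]
    refine lintegral_congr fun x => ?_
    rw [Pi.mul_apply, Real.mul_rpow zero_le_two ENNReal.toReal_nonneg,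
      ENNReal.ofReal_mul (by positivity),
      ← ENNReal.ofReal_rpow_of_nonneg ENNReal.toReal_nonneg hp1.le, ENNReal.ofReal_toReal (hut x)]
    have : u x ^ p = u x * u x ^ (p - 1) := by
      rcases eq_or_ne (u x) 0 with h | h
      · simp [h, hp0]
      · conv_rhs => enter [1]; rw [← ENNReal.rpow_one (u x)]
        rw [← ENNReal.rpow_add _ _ h (hut x)]; ring_nf
    rw [this]; ring
  have hpt : ∀ t ∈ Set.Ioi (0 : ℝ),
      μ {x | t < (hlMaximal μ u x).toReal} * ENNReal.ofReal (t ^ (p - 1)) ≤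
      2 * K * ((∫⁻ x in {x | t < 2 * (u x).toReal}, u x ∂μ) *
        ENNReal.ofReal (t ^ (p - 1 - 1))) := by
    intro t (ht : 0 < t)
    have h := mul_measure_lt_hlMaximal_le_setLIntegral μ hu
      (a := ENNReal.ofReal (t / 2)) ENNReal.ofReal_ne_top
    have h1 : {x | 2 * ENNReal.ofReal (t / 2) < hlMaximal μ u x} =
        {x | t < (hlMaximal μ u x).toReal} := by
      ext x
      rw [Set.mem_ofPred_eq, Set.mem_ofPred_eq, ← ENNReal.ofReal_lt_iff_lt_toReal ht.le (hMt x),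
        ← ENNReal.ofReal_ofNat 2, ← ENNReal.ofReal_mul zero_le_two, mul_div_cancel₀ t two_ne_zero]
    have h2 : {x | ENNReal.ofReal (t / 2) < u x} = {x | t < 2 * (u x).toReal} := by
      ext x
      rw [Set.mem_ofPred_eq, Set.mem_ofPred_eq, ENNReal.ofReal_lt_iff_lt_toReal (by positivity)
        (hut x), div_lt_iff₀' two_pos]
    rw [h1, h2] at h
    have h3 : ENNReal.ofReal (t ^ (p - 1)) =
        2 * ENNReal.ofReal (t / 2) * ENNReal.ofReal (t ^ (p - 1 - 1)) := by
      rw [← ENNReal.ofReal_ofNat 2, ← ENNReal.ofReal_mul zero_le_two,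
        ← ENNReal.ofReal_mul (by positivity), mul_div_cancel₀ t two_ne_zero,
        Real.rpow_sub_one ht.ne' (p - 1), mul_div_cancel₀ _ ht.ne']
    calc _ = 2 * (ENNReal.ofReal (t / 2) * μ {x | t < (hlMaximal μ u x).toReal}) *
          ENNReal.ofReal (t ^ (p - 1 - 1)) := by rw [h3]; ring
      _ ≤ 2 * (K * ∫⁻ x in {x | t < 2 * (u x).toReal}, u x ∂μ) *
          ENNReal.ofReal (t ^ (p - 1 - 1)) := by gcongr
      _ = _ := by ring
  have hKt : 2 * K ≠ ∞ := ENNReal.mul_ne_top (by simp) (by simp [K])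
  calc ∫⁻ x, hlMaximal μ u x ^ p ∂μ
      ≤ ENNReal.ofReal p * (2 * K * ∫⁻ t in Set.Ioi (0 : ℝ),
        (∫⁻ x in {x | t < 2 * (u x).toReal}, u x ∂μ) * ENNReal.ofReal (t ^ (p - 1 - 1))) := by
        rw [hlhs, ← lintegral_const_mul' _ _ hKt]
        gcongr ENNReal.ofReal p * ?_
        exact setLIntegral_mono' measurableSet_Ioi hpt
    _ = ENNReal.ofReal (p / (p - 1)) * 2 * K * (ENNReal.ofReal (p - 1) * ∫⁻ t in Set.Ioi (0 : ℝ),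
        (∫⁻ x in {x | t < 2 * (u x).toReal}, u x ∂μ) * ENNReal.ofReal (t ^ (p - 1 - 1))) := by
        rw [show ENNReal.ofReal p = ENNReal.ofReal (p / (p - 1)) * ENNReal.ofReal (p - 1) by
          rw [← ENNReal.ofReal_mul (by positivity), div_mul_cancel₀ _ hp1.ne']]
        ring
    _ = _ := by
        rw [← hrhs, ENNReal.ofReal_mul (by positivity), Real.rpow_sub_one two_ne_zero,
          show ENNReal.ofReal ((2 : ℝ) ^ p) = 2 * ENNReal.ofReal ((2 : ℝ) ^ p / 2) by
            rw [← ENNReal.ofReal_ofNat 2, ← ENNReal.ofReal_mul zero_le_two,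
              mul_div_cancel₀ _ two_ne_zero]]
        ring

end FiniteDimensional

end MaximalFunction

/-! ### Finiteness and continuity of the maximal function. -/

section MaximalFunctionOfContinuous

variable {E : Type*} [NormedAddCommGroup E] [MeasurableSpace E]

theorem hlMaximal_enorm_le_add {μ : Measure E} {f g : E → ℝ} (hf : Measurable f) (x : E) :
    hlMaximal μ (fun y => ‖g y‖ₑ) x ≤
      hlMaximal μ (fun y => ‖f y‖ₑ) x + hlMaximal μ (fun y => ‖g y - f y‖ₑ) x := by
  refine (hlMaximal_mono (fun y => ?_) x).trans (hlMaximal_add_le hf.enorm x)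
  calc ‖g y‖ₑ = ‖f y + (g y - f y)‖ₑ := by rw [add_sub_cancel]
    _ ≤ _ := enorm_add_le _ _

theorem enorm_toReal_sub_toReal_le {a b c : ℝ≥0∞} (ha : a ≠ ∞) (hb : b ≠ ∞) (hab : a ≤ b + c)
    (hba : b ≤ a + c) : ‖a.toReal - b.toReal‖ₑ ≤ c := by
  rcases eq_or_ne c ∞ with rfl | hc
  · exact le_top
  rw [← ofReal_norm, Real.norm_eq_abs]
  refine ENNReal.ofReal_le_of_le_toReal (abs_sub_le_iff.2 ⟨?_, ?_⟩)
  · have := ENNReal.toReal_mono (ENNReal.add_ne_top.2 ⟨hb, hc⟩) hab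
    rw [ENNReal.toReal_add hb hc] at this
    linarith
  · have := ENNReal.toReal_mono (ENNReal.add_ne_top.2 ⟨ha, hc⟩) hba
    rw [ENNReal.toReal_add ha hc] at this
    linarith

variable [BorelSpace E] [NormedSpace ℝ E] [FiniteDimensional ℝ E]

/-- Radii up to 1 use the local bound; larger radii use Hölder, with the ball's measure at least
that of the unit ball. -/
theorem hlMaximal_enorm_le_max (μ : Measure E) [μ.IsAddHaarMeasure] {p : ℝ≥0∞} (hp : 1 ≤ p)
    {f : E → ℝ} (hf : AEStronglyMeasurable f μ) {x : E} {c : ℝ≥0∞}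
    (hc : ∀ y ∈ Metric.ball x 1, ‖f y‖ₑ ≤ c) :
    hlMaximal μ (fun y => ‖f y‖ₑ) x ≤
      max c (eLpNorm f p μ * μ (Metric.ball 0 1) ^ (-(1 / p.toReal))) := by
  refine hlMaximal_le_iff.2 fun r hr => ?_
  rcases le_total r 1 with h1 | h1
  · refine le_max_of_le_left (ENNReal.div_le_of_le_mul ?_)
    rw [← setLIntegral_const]
    exact setLIntegral_mono' Metric.isOpen_ball.measurableSet fun y hy =>
      hc y (Metric.ball_subset_ball h1 hy)
  · refine le_max_of_le_right ?_
    have hV0 : μ (Metric.ball x r) ≠ 0 := (Metric.measure_ball_pos μ x hr).ne'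
    have hVt : μ (Metric.ball x r) ≠ ∞ := measure_ball_lt_top.ne
    have h := eLpNorm_le_eLpNorm_mul_rpow_measure_univ hp (hf.restrict (s := Metric.ball x r))
    rw [eLpNorm_one_eq_lintegral_enorm, Measure.restrict_apply_univ] at h
    calc (∫⁻ y in Metric.ball x r, ‖f y‖ₑ ∂μ) / μ (Metric.ball x r)
        ≤ eLpNorm f p μ * μ (Metric.ball x r) ^ (1 - 1 / p.toReal) / μ (Metric.ball x r) := by
          gcongr
          refine h.trans ?_
          rw [ENNReal.toReal_one, div_one]
          gcongr
          exact Measure.restrict_le_self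
      _ = eLpNorm f p μ * μ (Metric.ball x r) ^ (-(1 / p.toReal)) := by
          rw [mul_div_assoc, sub_eq_neg_add, ENNReal.rpow_add _ _ hV0 hVt, ENNReal.rpow_one,
            ENNReal.mul_div_cancel_right hV0 hVt]
      _ ≤ eLpNorm f p μ * μ (Metric.ball 0 1) ^ (-(1 / p.toReal)) := by
          rw [ENNReal.rpow_neg, ENNReal.rpow_neg, ← Measure.addHaar_ball_center μ x]
          gcongr

theorem hlMaximal_enorm_ne_top (μ : Measure E) [μ.IsAddHaarMeasure] {p : ℝ≥0∞} (hp : 1 ≤ p)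
    {f : E → ℝ} (hf : Continuous f) (hfp : MemLp f p μ) (x : E) :
    hlMaximal μ (fun y => ‖f y‖ₑ) x ≠ ∞ := by
  have := FiniteDimensional.proper_real E
  obtain ⟨C, hC⟩ := (isCompact_closedBall x 1).exists_bound_of_continuousOn hf.continuousOn
  refine ne_top_of_le_ne_top ?_ (hlMaximal_enorm_le_max μ hp hfp.1 (c := ENNReal.ofReal C)
    fun y hy => ?_)
  · refine (max_lt ENNReal.ofReal_lt_top (ENNReal.mul_lt_top hfp.2 ?_)).ne
    rw [ENNReal.rpow_neg, ENNReal.inv_lt_top]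
    exact ENNReal.rpow_pos (Metric.measure_ball_pos μ 0 one_pos) measure_ball_lt_top.ne
  · rw [← ofReal_norm]
    exact ENNReal.ofReal_le_ofReal (hC y (Metric.ball_subset_closedBall hy))

/-- Sublinearity plus commutation with translations; this transfers both continuity and Besov
regularity to the maximal function. -/
theorem enorm_hlMaximal_toReal_add_sub_le (μ : Measure E) [μ.IsAddHaarMeasure] {p : ℝ≥0∞}
    (hp : 1 ≤ p) {f : E → ℝ} (hf : Continuous f) (hfp : MemLp f p μ) (x h : E) :
    ‖(hlMaximal μ (fun y => ‖f y‖ₑ) (x + h)).toReal - (hlMaximal μ (fun y => ‖f y‖ₑ) x).toReal‖ₑ ≤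
      hlMaximal μ (fun y => ‖f (y + h) - f y‖ₑ) x := by
  refine enorm_toReal_sub_toReal_le (hlMaximal_enorm_ne_top μ hp hf hfp _)
    (hlMaximal_enorm_ne_top μ hp hf hfp _) ?_ ?_ <;>
  rw [← hlMaximal_comp_add_right μ (fun y => ‖f y‖ₑ) h x]
  · exact hlMaximal_enorm_le_add hf.measurable x
  · have := hlMaximal_enorm_le_add (μ := μ) (f := fun y => f (y + h)) (g := f)
      (hf.comp (continuous_add_const h)).measurable x
    simpa only [enorm_sub_rev] using this

/-- The maximal function of a continuous `L^p` function whose translates vary continuously in `L^p`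
is continuous. -/
theorem continuous_hlMaximal_toReal (μ : Measure E) [μ.IsAddHaarMeasure] {p : ℝ≥0∞}
    (hp : 1 ≤ p) {f : E → ℝ} (hf : Continuous f) (hfp : MemLp f p μ)
    (hft : Tendsto (fun h => eLpNorm (fun x => f (x + h) - f x) p μ) (𝓝 0) (𝓝 0)) :
    Continuous fun x => (hlMaximal μ (fun y => ‖f y‖ₑ) x).toReal := by
  have := FiniteDimensional.proper_real E
  have hdiff : ∀ h, Continuous fun y => f (y + h) - f y := fun h => by fun_prop
  refine continuous_iff_continuousAt.2 fun x => ?_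
  have hM : Tendsto (fun h => hlMaximal μ (fun y => ‖f (y + h) - f y‖ₑ) x) (𝓝 0) (𝓝 0) := by
    rw [ENNReal.tendsto_nhds_zero]
    intro ε hε
    have h1 : ∀ᶠ h in 𝓝 (0 : E), ∀ y ∈ Metric.closedBall x 1, ‖f (y + h) - f y‖ₑ ≤ ε := by
      refine (isCompact_closedBall x 1).eventually_forall_of_forall_eventually fun y _ => ?_
      have hc : Continuous fun z : E × E => ‖f (z.2 + z.1) - f z.2‖ₑ := by fun_prop
      have := hc.tendsto (0, y)
      simp only [add_zero, sub_self, enorm_zero] at this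
      exact (ENNReal.tendsto_nhds_zero.1 this) ε hε
    have hVt : μ (Metric.ball 0 1) ^ (-(1 / p.toReal)) ≠ ∞ := by
      rw [ENNReal.rpow_neg]
      exact (ENNReal.inv_lt_top.2
        (ENNReal.rpow_pos (Metric.measure_ball_pos μ 0 one_pos) measure_ball_lt_top.ne)).ne
    have h2 := ENNReal.Tendsto.mul_const hft (Or.inr hVt)
    rw [zero_mul] at h2
    filter_upwards [h1, ENNReal.tendsto_nhds_zero.1 h2 ε hε] with h hh1 hh2
    exact (hlMaximal_enorm_le_max μ hp (hdiff h).aestronglyMeasurable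
      fun y hy => hh1 y (Metric.ball_subset_closedBall hy)).trans (max_le le_rfl hh2)
  have hsub : Tendsto (fun h => ‖(hlMaximal μ (fun y => ‖f y‖ₑ) (x + h)).toReal -
      (hlMaximal μ (fun y => ‖f y‖ₑ) x).toReal‖ₑ) (𝓝 0) (𝓝 0) :=
    tendsto_of_tendsto_of_tendsto_of_le_of_le tendsto_const_nhds hM (fun _ => zero_le)
      (fun h => enorm_hlMaximal_toReal_add_sub_le μ hp hf hfp x h)
  have hsub' := (hsub.comp (f := fun y => y - x) (x := 𝓝 x)
    (by simpa using (continuous_sub_right x).tendsto x))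
  rw [ContinuousAt, tendsto_iff_edist_tendsto_0]
  simpa [Function.comp_def, edist_eq_enorm_sub] using hsub'

end MaximalFunctionOfContinuous

/-! ### Boundedness of the maximal operator on the Besov class. -/

section MaximalFunctionBesov

variable {n : ℕ} {α p : ℝ} {f : EuclideanSpace ℝ (Fin n) → ℝ}

theorem eLpNorm_translate_sub_le (α : ℝ) (p : ℝ≥0∞) (f : EuclideanSpace ℝ (Fin n) → ℝ)
    {h : EuclideanSpace ℝ (Fin n)} (hh : h ≠ 0) :
    eLpNorm (fun x => f (x + h) - f x) p volume ≤
      besovSeminorm α p f * ENNReal.ofReal (‖h‖ ^ α) := by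
  have hpos : 0 < ‖h‖ ^ α := Real.rpow_pos_of_pos (norm_pos_iff.2 hh) α
  rw [← ENNReal.div_le_iff (ENNReal.ofReal_pos.2 hpos).ne' ENNReal.ofReal_ne_top]
  exact le_iSup₂ (f := fun (h : EuclideanSpace ℝ (Fin n)) (_ : h ≠ 0) =>
    eLpNorm (fun x => f (x + h) - f x) p volume / ENNReal.ofReal (‖h‖ ^ α)) h hh

theorem tendsto_eLpNorm_translate_sub (hα : 0 < α) {p : ℝ≥0∞} (hf : besovSeminorm α p f < ∞) :
    Tendsto (fun h => eLpNorm (fun x => f (x + h) - f x) p volume) (𝓝 0) (𝓝 0) := by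
  have hlim : Tendsto (fun h : EuclideanSpace ℝ (Fin n) =>
      besovSeminorm α p f * ENNReal.ofReal (‖h‖ ^ α)) (𝓝 0) (𝓝 0) := by
    have h1 : Continuous fun h : EuclideanSpace ℝ (Fin n) => ENNReal.ofReal (‖h‖ ^ α) :=
      ENNReal.continuous_ofReal.comp (continuous_norm.rpow_const fun _ => Or.inr hα.le)
    have h2 := ENNReal.Tendsto.const_mul (h1.tendsto 0) (Or.inr hf.ne)
    simpa [Real.zero_rpow hα.ne'] using h2
  refine tendsto_of_tendsto_of_tendsto_of_le_of_le tendsto_const_nhds hlim (fun _ => zero_le)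
    fun h => ?_
  rcases eq_or_ne h 0 with rfl | hh
  · simp
  · exact eLpNorm_translate_sub_le α p f hh

theorem exists_besov_hlMaximal (hn : n ≠ 0) (hα : 0 < α) (hp : 1 < p) :
    ∃ A : ℝ≥0, ∀ f ∈ continuousBesov n α (ENNReal.ofReal p),
      (fun x => (hlMaximal volume (fun y => ‖f y‖ₑ) x).toReal) ∈
        continuousBesov n α (ENNReal.ofReal p) ∧
      besovSeminorm α (ENNReal.ofReal p)
        (fun x => (hlMaximal volume (fun y => ‖f y‖ₑ) x).toReal) ≤
          A * besovSeminorm α (ENNReal.ofReal p) f := by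
  have : Nonempty (Fin n) := Fin.pos_iff_nonempty.1 (Nat.pos_of_ne_zero hn)
  have hp0 : 0 < p := one_pos.trans hp
  have hP0 : ENNReal.ofReal p ≠ 0 := (ENNReal.ofReal_pos.2 hp0).ne'
  have hP1 : 1 ≤ ENNReal.ofReal p := ENNReal.one_le_ofReal.2 hp.le
  set B : ℝ≥0∞ := ENNReal.ofReal (p / (p - 1) * 2 ^ p) *
    4 ^ Module.finrank ℝ (EuclideanSpace ℝ (Fin n)) with hB
  have hBt : B ^ (1 / p) ≠ ∞ := ENNReal.rpow_ne_top_of_nonneg (by positivity)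
    (ENNReal.mul_ne_top ENNReal.ofReal_ne_top (by simp))
  -- Used twice: for g = f(· + h) - f to bound the seminorm, and for g = f to get membership in L^p.
  have key : ∀ g : EuclideanSpace ℝ (Fin n) → ℝ, Continuous g → MemLp g (ENNReal.ofReal p) volume →
      ∀ F : EuclideanSpace ℝ (Fin n) → ℝ, (∀ x, ‖F x‖ₑ ≤ hlMaximal volume (fun y => ‖g y‖ₑ) x) →
      eLpNorm F (ENNReal.ofReal p) volume ≤ B ^ (1 / p) * eLpNorm g (ENNReal.ofReal p) volume := by
    intro g hg hgp F hF
    rw [eLpNorm_eq_lintegral_rpow_enorm_toReal hP0 ENNReal.ofReal_ne_top,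
      eLpNorm_eq_lintegral_rpow_enorm_toReal hP0 ENNReal.ofReal_ne_top,
      ENNReal.toReal_ofReal hp0.le, ← ENNReal.mul_rpow_of_nonneg _ _ (by positivity)]
    gcongr
    refine (lintegral_mono fun x => ?_).trans (lintegral_hlMaximal_rpow_le volume hp
      hg.measurable.enorm (fun _ => enorm_ne_top) (hlMaximal_enorm_ne_top volume hP1 hg hgp))
    gcongr
    exact hF x
  refine ⟨(B ^ (1 / p)).toNNReal, fun f ⟨hfc, hfp, hfb⟩ => ?_⟩
  rw [ENNReal.coe_toNNReal hBt]
  have hsemi : besovSeminorm α (ENNReal.ofReal p)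
      (fun x => (hlMaximal volume (fun y => ‖f y‖ₑ) x).toReal) ≤
        B ^ (1 / p) * besovSeminorm α (ENNReal.ofReal p) f := by
    refine iSup₂_le fun h hh => ENNReal.div_le_of_le_mul ?_
    have htr : MemLp (fun x => f (x + h)) (ENNReal.ofReal p) volume :=
      hfp.comp_measurePreserving (measurePreserving_add_right volume h)
    refine (key (fun x => f (x + h) - f x) (by fun_prop) (htr.sub hfp) _
      fun x => enorm_hlMaximal_toReal_add_sub_le volume hP1 hfc hfp x h).trans ?_
    rw [mul_assoc]
    gcongr
    exact eLpNorm_translate_sub_le α _ f hh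
  have hcont := continuous_hlMaximal_toReal volume hP1 hfc hfp
    (tendsto_eLpNorm_translate_sub hα hfb)
  refine ⟨⟨hcont, ⟨hcont.aestronglyMeasurable, ?_⟩, hsemi.trans_lt ?_⟩, hsemi⟩
  · refine (key f hfc hfp _ fun x => ?_).trans_lt (ENNReal.mul_lt_top hBt.lt_top hfp.2)
    rw [Real.enorm_of_nonneg ENNReal.toReal_nonneg]
    exact ENNReal.ofReal_toReal_le
  · exact ENNReal.mul_lt_top hBt.lt_top hfb

end MaximalFunctionBesov

/-! ### Heat extension against the maximal function, and its lower bound on tents. -/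

section HeatExtension

variable {n : ℕ}

/-- At time t² the kernel's normalisation cancels the t^n in the volume of a ball of radius t, so θ
and κ do not depend on t. -/
theorem four_pi_sq_rpow_mul_pow (n : ℕ) {t : ℝ} (ht : 0 < t) :
    (4 * Real.pi * t ^ 2) ^ (-(n : ℝ) / 2) * t ^ n = (4 * Real.pi) ^ (-(n : ℝ) / 2) := by
  rw [Real.mul_rpow (by positivity) (by positivity), ← Real.rpow_natCast t 2, ← Real.rpow_mul ht.le,
    mul_assoc, ← Real.rpow_natCast t n, ← Real.rpow_add ht]
  simp [mul_div_cancel₀]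

theorem summable_exp_mul_add_two_pow (n : ℕ) :
    Summable fun k : ℕ => Real.exp (-(k : ℝ) / 4) * ((k : ℝ) + 2) ^ n := by
  have h := ((summable_nat_add_iff 2).2
    (Real.summable_pow_mul_exp_neg_nat_mul n (r := 1 / 4) (by norm_num))).mul_left
      (Real.exp (1 / 2))
  refine h.congr fun k => ?_
  rw [mul_left_comm, ← Real.exp_add, mul_comm]
  push_cast
  ring_nf

/-- The Gauss-Weierstrass average of `|f|` over the nontangential approach region of `y` is
controlled by the maximal function at `y`. -/
theorem exists_lintegral_heatKernel_le_hlMaximal (n : ℕ) :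
    ∃ θ : ℝ≥0, ∀ f : EuclideanSpace ℝ (Fin n) → ℝ, Measurable f → ∀ t : ℝ, 0 < t →
      ∀ x y : EuclideanSpace ℝ (Fin n), y ∈ Metric.ball x t →
      ENNReal.ofReal ((4 * Real.pi * t ^ 2) ^ (-(n : ℝ) / 2)) *
        ∫⁻ z, ‖Real.exp (-(‖x - z‖ ^ 2) / (4 * t ^ 2)) * f z‖ₑ ≤
          θ * hlMaximal volume (fun z => ‖f z‖ₑ) y := by
  set V : ℝ≥0∞ := volume (Metric.ball (0 : EuclideanSpace ℝ (Fin n)) 1) with hV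
  have hVt : V ≠ ∞ := measure_ball_lt_top.ne
  set S : ℝ := ∑' k : ℕ, Real.exp (-(k : ℝ) / 4) * ((k : ℝ) + 2) ^ n with hS
  refine ⟨(ENNReal.ofReal ((4 * Real.pi) ^ (-(n : ℝ) / 2)) * ENNReal.ofReal S * V).toNNReal,
    fun f hf t ht x y hy => ?_⟩
  rw [ENNReal.coe_toNNReal (by finiteness)]
  set M := hlMaximal volume (fun z => ‖f z‖ₑ) y with hM
  -- With s = |x - z|/t and k = ⌊s⌋, k ≤ k² ≤ s² bounds the Gaussian by exp(-k/4), which is summable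
  -- against (k+2)^n.
  have hpt : ∀ z, ‖Real.exp (-(‖x - z‖ ^ 2) / (4 * t ^ 2)) * f z‖ₑ ≤
      ∑' k : ℕ, (Metric.ball x ((k + 1) * t)).indicator
        (fun z => ENNReal.ofReal (Real.exp (-(k : ℝ) / 4)) * ‖f z‖ₑ) z := by
    intro z
    set s := ‖x - z‖ / t with hs
    have hs0 : 0 ≤ s := by positivity
    set k := ⌊s⌋₊ with hk
    have hks : (k : ℝ) ≤ s := Nat.floor_le hs0
    have hsk : s < k + 1 := Nat.lt_floor_add_one s
    have hz : z ∈ Metric.ball x ((k + 1) * t) := by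
      rw [Metric.mem_ball', dist_eq_norm]
      exact (div_lt_iff₀ ht).1 hsk
    refine le_trans ?_ (ENNReal.le_tsum k)
    rw [Set.indicator_of_mem hz, enorm_mul, Real.enorm_of_nonneg (Real.exp_pos _).le]
    refine mul_le_mul_left (ENNReal.ofReal_le_ofReal (Real.exp_le_exp.2 ?_)) _
    have h1 : -(‖x - z‖ ^ 2) / (4 * t ^ 2) = -(s ^ 2) / 4 := by
      rw [hs]; field_simp
    have h2 : (k : ℝ) ≤ (k : ℝ) ^ 2 := by exact_mod_cast Nat.le_self_pow two_ne_zero k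
    have h3 : (k : ℝ) ^ 2 ≤ s ^ 2 := by gcongr
    rw [h1]
    linarith
  have hterm : ∀ k : ℕ, ∫⁻ z, (Metric.ball x ((k + 1) * t)).indicator
        (fun z => ENNReal.ofReal (Real.exp (-(k : ℝ) / 4)) * ‖f z‖ₑ) z ≤
      ENNReal.ofReal (Real.exp (-(k : ℝ) / 4) * ((k : ℝ) + 2) ^ n) *
        (ENNReal.ofReal (t ^ n) * V * M) := by
    intro k
    have hr : 0 < ((k : ℝ) + 2) * t := by positivity
    have hV0 := (Metric.measure_ball_pos volume y hr).ne'
    -- Recentring from x to y costs one extra t in the radius, as |x - y| < t.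
    have hball : ∫⁻ z in Metric.ball x ((k + 1) * t), ‖f z‖ₑ ≤
        M * volume (Metric.ball y ((k + 2) * t)) := by
      rw [← ENNReal.div_le_iff hV0 measure_ball_lt_top.ne]
      refine le_trans ?_ (laverage_ball_le_hlMaximal volume _ y hr)
      gcongr
      refine Metric.ball_subset_ball' ?_
      have := Metric.mem_ball'.1 hy
      linarith
    rw [lintegral_indicator Metric.isOpen_ball.measurableSet,
      lintegral_const_mul' _ _ ENNReal.ofReal_ne_top]
    refine (mul_le_mul_right hball _).trans_eq ?_
    rw [Measure.addHaar_ball_of_pos volume y hr, finrank_euclideanSpace_fin, mul_pow,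
      ENNReal.ofReal_mul (by positivity), ENNReal.ofReal_mul (by positivity)]
    ring
  calc _ ≤ ENNReal.ofReal ((4 * Real.pi * t ^ 2) ^ (-(n : ℝ) / 2)) *
        ∑' k : ℕ, ENNReal.ofReal (Real.exp (-(k : ℝ) / 4) * ((k : ℝ) + 2) ^ n) *
          (ENNReal.ofReal (t ^ n) * V * M) := by
        gcongr
        refine (lintegral_mono hpt).trans ?_
        rw [lintegral_tsum fun k => ((hf.enorm.const_mul _).indicator
          Metric.isOpen_ball.measurableSet).aemeasurable]
        exact ENNReal.tsum_le_tsum hterm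
    _ = _ := by
        rw [ENNReal.tsum_mul_right, ← ENNReal.ofReal_tsum_of_nonneg (fun k => by positivity)
          (summable_exp_mul_add_two_pow n), ← four_pi_sq_rpow_mul_pow n ht,
          ENNReal.ofReal_mul (by positivity)]
        ring

theorem enorm_heatExtension_le (f : EuclideanSpace ℝ (Fin n) → ℝ) {s : ℝ} (hs : 0 ≤ s)
    (x : EuclideanSpace ℝ (Fin n)) :
    ‖heatExtension f s x‖ₑ ≤ ENNReal.ofReal ((4 * Real.pi * s) ^ (-(n : ℝ) / 2)) *
        ∫⁻ z, ‖Real.exp (-(‖x - z‖ ^ 2) / (4 * s)) * f z‖ₑ := by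
  rw [heatExtension, enorm_mul, Real.enorm_of_nonneg (by positivity)]
  gcongr
  exact enorm_integral_le_lintegral_enorm _

theorem integrable_heatKernel_mul {p : ℝ≥0∞} (hp : 1 ≤ p) {f : EuclideanSpace ℝ (Fin n) → ℝ}
    (hf : Continuous f) (hfp : MemLp f p volume) {t : ℝ} (ht : 0 < t)
    (x : EuclideanSpace ℝ (Fin n)) :
    Integrable fun z => Real.exp (-(‖x - z‖ ^ 2) / (4 * t ^ 2)) * f z := by
  obtain ⟨θ, hθ⟩ := exists_lintegral_heatKernel_le_hlMaximal n
  refine ⟨by fun_prop, ?_⟩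
  have h := (hθ f hf.measurable t ht x x (Metric.mem_ball_self ht)).trans_lt
    (ENNReal.mul_lt_top ENNReal.coe_lt_top (hlMaximal_enorm_ne_top volume hp hf hfp x).lt_top)
  refine ENNReal.lt_top_of_mul_ne_top_right h.ne (ENNReal.ofReal_pos.2 ?_).ne'
  positivity

theorem exists_le_heatExtension (n : ℕ) :
    ∃ κ : ℝ, 0 < κ ∧ ∀ p : ℝ≥0∞, 1 ≤ p → ∀ f : EuclideanSpace ℝ (Fin n) → ℝ, Continuous f →
      MemLp f p volume → (∀ x, 0 ≤ f x) → ∀ t : ℝ, 0 < t → ∀ x : EuclideanSpace ℝ (Fin n),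
      (∀ y ∈ Metric.ball x t, 1 ≤ f y) → κ ≤ heatExtension f (t ^ 2) x := by
  set V : ℝ := volume.real (Metric.ball (0 : EuclideanSpace ℝ (Fin n)) 1) with hV
  have hVpos : 0 < V := ENNReal.toReal_pos (Metric.measure_ball_pos volume 0 one_pos).ne'
    measure_ball_lt_top.ne
  refine ⟨(4 * Real.pi) ^ (-(n : ℝ) / 2) * (Real.exp (-1 / 4) * V), by positivity,
    fun p hp f hf hfp h0 t ht x h1 => ?_⟩
  have hint := integrable_heatKernel_mul hp hf hfp ht x
  have hvol : volume.real (Metric.ball x t) = t ^ n * V := by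
    rw [Measure.real, Measure.addHaar_ball_of_pos volume x ht, finrank_euclideanSpace_fin,
      ENNReal.toReal_mul, ENNReal.toReal_ofReal (by positivity)]
    rfl
  have hle : Real.exp (-1 / 4) * (t ^ n * V) ≤
      ∫ z, Real.exp (-(‖x - z‖ ^ 2) / (4 * t ^ 2)) * f z := by
    calc Real.exp (-1 / 4) * (t ^ n * V)
        = ∫ _ in Metric.ball x t, Real.exp (-1 / 4) := by
          rw [setIntegral_const, hvol, smul_eq_mul, mul_comm]
      _ ≤ ∫ z in Metric.ball x t, Real.exp (-(‖x - z‖ ^ 2) / (4 * t ^ 2)) * f z := by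
          refine setIntegral_mono_on (integrableOn_const measure_ball_lt_top.ne) hint.integrableOn
            Metric.isOpen_ball.measurableSet fun z hz => ?_
          refine le_trans ?_ (le_mul_of_one_le_right (Real.exp_pos _).le (h1 z hz))
          rw [Real.exp_le_exp, div_le_div_iff₀ (by norm_num) (by positivity)]
          have hz' : ‖x - z‖ < t := by rw [← dist_eq_norm]; exact Metric.mem_ball'.1 hz
          have : ‖x - z‖ ^ 2 ≤ t ^ 2 := by gcongr
          linarith
      _ ≤ _ := setIntegral_le_integral hint
          (ae_of_all _ fun z => mul_nonneg (Real.exp_pos _).le (h0 z))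
  rw [heatExtension, ← four_pi_sq_rpow_mul_pow n ht]
  calc _ = (4 * Real.pi * t ^ 2) ^ (-(n : ℝ) / 2) * (Real.exp (-1 / 4) * (t ^ n * V)) := by ring
    _ ≤ _ := by gcongr

end HeatExtension

/-! ### Stability of the Besov class under scaling and absolute value. -/

section BesovClass

variable {n : ℕ} {α : ℝ} {p : ℝ≥0∞} {f : EuclideanSpace ℝ (Fin n) → ℝ}

theorem besovSeminorm_const_mul_le (α : ℝ) (p : ℝ≥0∞) (c : ℝ)
    (f : EuclideanSpace ℝ (Fin n) → ℝ) :
    besovSeminorm α p (fun x => c * f x) ≤ ‖c‖ₑ * besovSeminorm α p f := by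
  refine iSup₂_le fun h hh => ENNReal.div_le_of_le_mul ?_
  simp only [← mul_sub]
  refine (eLpNorm_const_smul_le (c := c) (f := fun x => f (x + h) - f x)).trans ?_
  rw [mul_assoc]
  gcongr
  exact eLpNorm_translate_sub_le α p f hh

theorem const_mul_mem_continuousBesov (c : ℝ) (hf : f ∈ continuousBesov n α p) :
    (fun x => c * f x) ∈ continuousBesov n α p :=
  ⟨hf.1.const_mul c, hf.2.1.const_mul c, (besovSeminorm_const_mul_le α p c f).trans_lt
    (ENNReal.mul_lt_top enorm_lt_top hf.2.2)⟩

theorem besovSeminorm_abs_le (α : ℝ) (p : ℝ≥0∞) (f : EuclideanSpace ℝ (Fin n) → ℝ) :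
    besovSeminorm α p (fun x => |f x|) ≤ besovSeminorm α p f :=
  iSup₂_mono fun _ _ => ENNReal.div_le_div_right
    (eLpNorm_mono fun x => by simpa using abs_abs_sub_abs_le (f _) (f x)) _

theorem abs_mem_continuousBesov (hf : f ∈ continuousBesov n α p) :
    (fun x => |f x|) ∈ continuousBesov n α p :=
  ⟨hf.1.abs, hf.2.1.abs, (besovSeminorm_abs_le α p f).trans_lt hf.2.2⟩

end BesovClass

/-! ### The two implications. -/

/-- A tent over `O` lies in a superlevel set of the heat extension of `|f|` if `f` is at least `1`
on `O`; this bounds `ν (tent O)` by the capacity of `O`. -/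
theorem exists_measure_tent_le_of_weakType {n : ℕ} {α p q : ℝ} (hp : 1 < p) (hq : 0 < q)
    (ν : OuterMeasure (UpperHalfSpace n)) {C : ℝ≥0}
    (hC : ∀ f ∈ continuousBesov n α (ENNReal.ofReal p),
      (⨆ (l : ℝ) (_ : 0 < l), (ENNReal.ofReal l ^ q *
          ν {z : UpperHalfSpace n | l < |heatExtension f ((z.1 : ℝ) ^ 2) z.2|}) ^ (1 / q))
        ≤ C * besovSeminorm α (ENNReal.ofReal p) f) :
    ∃ C : ℝ≥0, 0 < C ∧ ∀ O : Set (EuclideanSpace ℝ (Fin n)), IsOpen O →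
      ν (tent O) ≤ C * besovCapacity α p O ^ (q / p) := by
  obtain ⟨κ, hκ, hheat⟩ := exists_le_heatExtension n
  have hp0 : 0 < p := one_pos.trans hp
  have hl : 0 < κ / 2 := half_pos hκ
  set a : ℝ≥0∞ := ENNReal.ofReal (κ / 2) with ha
  have ha0 : a ≠ 0 := (ENNReal.ofReal_pos.2 hl).ne'
  have hat : a ≠ ∞ := ENNReal.ofReal_ne_top
  -- C may be 0 here; C + 1 keeps the final constant positive. The level κ/2 turns the bound κ ≤ w
  -- into a strict one.
  set D : ℝ≥0∞ := ((C + 1) / a) with hD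
  have hD0 : D ≠ 0 := ENNReal.div_ne_zero.2 ⟨by simp, hat⟩
  have hDt : D ≠ ∞ := ENNReal.div_ne_top (by simp) ha0
  have hDq : D ^ q ≠ ∞ := ENNReal.rpow_ne_top_of_nonneg hq.le hDt
  refine ⟨(D ^ q).toNNReal, ENNReal.toNNReal_pos (ENNReal.rpow_pos hD0.bot_lt hDt).ne' hDq,
    fun O _ => ?_⟩
  rw [ENNReal.coe_toNNReal hDq]
  -- Raised to the power p/q, the left side is free of f and the infimum defining the capacity can
  -- be taken directly.
  have key : ∀ f ∈ besovAdmissible α (ENNReal.ofReal p) O,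
      (ν (tent O) / D ^ q) ^ (p / q) ≤ besovSeminorm α (ENNReal.ofReal p) f ^ p := by
    rintro f ⟨hf, N, hN, hfN⟩
    have hsub : tent O ⊆
        {z | κ / 2 < |heatExtension (fun x => |f x|) ((z.1 : ℝ) ^ 2) z.2|} := by
      intro z hz
      have := hheat (ENNReal.ofReal p) (ENNReal.one_le_ofReal.2 hp.le) _ hf.1.abs hf.2.1.abs
        (fun x => abs_nonneg _) z.1 z.1.2 z.2
        fun y hy => (hfN y (subset_of_mem_nhdsSet hN (hz hy))).trans (le_abs_self _)
      exact (half_lt_self hκ).trans_le (this.trans (le_abs_self _))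
    have h1 : (a ^ q * ν (tent O)) ^ (1 / q) ≤
        (C + 1) * besovSeminorm α (ENNReal.ofReal p) f := by
      calc (a ^ q * ν (tent O)) ^ (1 / q)
          ≤ (a ^ q * ν {z | κ / 2 < |heatExtension (fun x => |f x|) ((z.1 : ℝ) ^ 2) z.2|})
              ^ (1 / q) := by gcongr
        _ ≤ C * besovSeminorm α (ENNReal.ofReal p) (fun x => |f x|) :=
            (le_iSup₂ (f := fun (l : ℝ) (_ : 0 < l) => (ENNReal.ofReal l ^ q *
              ν {z : UpperHalfSpace n |
                l < |heatExtension (fun x => |f x|) ((z.1 : ℝ) ^ 2) z.2|}) ^ (1 / q)) _ hl).trans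
              (hC _ (abs_mem_continuousBesov hf))
        _ ≤ _ := mul_le_mul' le_self_add (besovSeminorm_abs_le α _ f)
    have h2 : ν (tent O) / D ^ q ≤ besovSeminorm α (ENNReal.ofReal p) f ^ q := by
      rw [one_div, ENNReal.rpow_inv_le_iff hq, ENNReal.mul_rpow_of_nonneg _ _ hq.le] at h1
      refine ENNReal.div_le_of_le_mul' ?_
      rw [hD, ENNReal.div_rpow_of_nonneg _ _ hq.le, ← ENNReal.mul_div_right_comm,
        ENNReal.le_div_iff_mul_le (Or.inl (ENNReal.rpow_pos ha0.bot_lt hat).ne')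
          (Or.inl (ENNReal.rpow_ne_top_of_nonneg hq.le hat)), mul_comm]
      exact h1
    calc (ν (tent O) / D ^ q) ^ (p / q)
        ≤ (besovSeminorm α (ENNReal.ofReal p) f ^ q) ^ (p / q) := by gcongr
      _ = besovSeminorm α (ENNReal.ofReal p) f ^ p := by
          rw [← ENNReal.rpow_mul, mul_div_cancel₀ _ hq.ne']
  have hcap : (ν (tent O) / D ^ q) ^ (p / q) ≤ besovCapacity α p O := le_iInf₂ key
  have h3 : ν (tent O) / D ^ q ≤ besovCapacity α p O ^ (q / p) := by
    rw [← inv_div q p, ENNReal.rpow_inv_le_iff (by positivity)] at hcap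
    exact hcap
  rw [ENNReal.div_le_iff' (ENNReal.rpow_pos hD0.bot_lt hDt).ne' hDq] at h3
  exact h3

/-- A capacitary bound for tents gives the weak-type inequality: the set where the heat extension
is large lies in the tent over a superlevel set of the maximal function. -/
theorem exists_weakType_of_measure_tent_le {n : ℕ} {α p q : ℝ} (hn : n ≠ 0) (hα : 0 < α)
    (hp : 1 < p) (hq : 0 < q) (ν : OuterMeasure (UpperHalfSpace n)) {C : ℝ≥0}
    (hC : ∀ O : Set (EuclideanSpace ℝ (Fin n)), IsOpen O →
      ν (tent O) ≤ C * besovCapacity α p O ^ (q / p)) :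
    ∃ C : ℝ≥0, 0 < C ∧ ∀ f ∈ continuousBesov n α (ENNReal.ofReal p),
      (⨆ (l : ℝ) (_ : 0 < l), (ENNReal.ofReal l ^ q *
          ν {z : UpperHalfSpace n | l < |heatExtension f ((z.1 : ℝ) ^ 2) z.2|}) ^ (1 / q))
        ≤ C * besovSeminorm α (ENNReal.ofReal p) f := by
  obtain ⟨A, hA⟩ := exists_besov_hlMaximal hn hα hp
  obtain ⟨θ, hθ⟩ := exists_lintegral_heatKernel_le_hlMaximal n
  have hp0 : 0 < p := one_pos.trans hp
  refine ⟨C ^ (1 / q) * (θ * A) + 1, by positivity, fun f hf => iSup₂_le fun l hl => ?_⟩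
  obtain ⟨hg, hgA⟩ := hA f hf
  set g := fun x => (hlMaximal volume (fun y => ‖f y‖ₑ) x).toReal with hgdef
  have hMt : ∀ x, hlMaximal volume (fun y => ‖f y‖ₑ) x ≠ ∞ :=
    hlMaximal_enorm_ne_top volume (ENNReal.one_le_ofReal.2 hp.le) hf.1 hf.2.1
  set O := {y | 1 < θ / l * g y} with hO
  have hOo : IsOpen O := isOpen_lt continuous_const (hg.1.const_mul _)
  have hsub : {z : UpperHalfSpace n | l < |heatExtension f ((z.1 : ℝ) ^ 2) z.2|} ⊆ tent O := by
    intro z hz y hy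
    have h := (enorm_heatExtension_le f (sq_nonneg (z.1 : ℝ)) z.2).trans
      (hθ f hf.1.measurable z.1 z.1.2 z.2 y hy)
    have h' := ENNReal.toReal_mono (ENNReal.mul_ne_top ENNReal.coe_ne_top (hMt y)) h
    rw [toReal_enorm, Real.norm_eq_abs, ENNReal.toReal_mul, ENNReal.coe_toReal] at h'
    have h2 : l < θ * g y := lt_of_lt_of_le hz h'
    change 1 < θ / l * g y
    rw [div_mul_eq_mul_div, one_lt_div hl]
    exact h2
  set s := besovSeminorm α (ENNReal.ofReal p) f with hs
  set b := ENNReal.ofReal l with hb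
  have hb0 : b ≠ 0 := (ENNReal.ofReal_pos.2 hl).ne'
  have hbt : b ≠ ∞ := ENNReal.ofReal_ne_top
  -- Since O is open, it serves as its own neighbourhood for the test function (θ/l)g.
  have hcap : besovCapacity α p O ≤ (θ / b * (A * s)) ^ p := by
    refine (iInf₂_le (fun x => θ / l * g x) ⟨const_mul_mem_continuousBesov _ hg, O,
      hOo.mem_nhdsSet_self, fun x hx => le_of_lt hx⟩).trans ?_
    gcongr
    refine (besovSeminorm_const_mul_le α _ _ g).trans ?_
    gcongr
    rw [Real.enorm_of_nonneg (by positivity), ENNReal.ofReal_div_of_pos hl, ENNReal.ofReal_coe_nnreal]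
  have hν : ν {z : UpperHalfSpace n | l < |heatExtension f ((z.1 : ℝ) ^ 2) z.2|} ≤
      C * (θ / b * (A * s)) ^ q := by
    calc _ ≤ ν (tent O) := measure_mono hsub
      _ ≤ C * besovCapacity α p O ^ (q / p) := hC O hOo
      _ ≤ C * ((θ / b * (A * s)) ^ p) ^ (q / p) := by gcongr
      _ = _ := by rw [← ENNReal.rpow_mul, mul_div_cancel₀ _ hp0.ne']
  calc _ ≤ (b ^ q * (C * (θ / b * (A * s)) ^ q)) ^ (1 / q) := by gcongr
    _ = ((C : ℝ≥0∞) * (b * (θ / b * (A * s))) ^ q) ^ (1 / q) := by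
        rw [ENNReal.mul_rpow_of_nonneg b _ hq.le, mul_left_comm]
    _ = (C : ℝ≥0∞) ^ (1 / q) * (θ * (A * s)) := by
        rw [← mul_assoc b, ENNReal.mul_div_cancel hb0 hbt,
          ENNReal.mul_rpow_of_nonneg _ _ (by positivity), ← ENNReal.rpow_mul,
          mul_one_div_cancel hq.ne', ENNReal.rpow_one]
    _ ≤ _ := by
        rw [ENNReal.coe_add, ENNReal.coe_mul, ENNReal.coe_rpow_of_nonneg _ (by positivity),
          ENNReal.coe_mul, add_mul, ← mul_assoc (θ : ℝ≥0∞), ← mul_assoc]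
        exact le_self_add

theorem propositionp32 (n : ℕ) (α p q : ℝ) (hα : α ∈ Set.Ioo (0 : ℝ) 1)
    (hp : p ∈ Set.Ioo (1 : ℝ) ((n : ℝ) / α)) (hq : 1 ≤ q)
    (ν : OuterMeasure (UpperHalfSpace n)) :
    (∃ C : ℝ≥0, 0 < C ∧ ∀ f ∈ continuousBesov n α (ENNReal.ofReal p),
      (⨆ (l : ℝ) (_ : 0 < l),
        (ENNReal.ofReal l ^ q *
          ν {z : UpperHalfSpace n | l < |heatExtension f ((z.1 : ℝ) ^ 2) z.2|}) ^ (1 / q))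
        ≤ C * besovSeminorm α (ENNReal.ofReal p) f) ↔
    (∃ C : ℝ≥0, 0 < C ∧ ∀ O : Set (EuclideanSpace ℝ (Fin n)), IsOpen O →
      ν (tent O) ≤ C * besovCapacity α p O ^ (q / p)) := by
  have hq0 : 0 < q := one_pos.trans_le hq
  -- For n = 0 the range 1 < p < n/α is empty; the covering argument needs positive dimension.
  have hn : n ≠ 0 := by
    rintro rfl
    have := hp.1.trans hp.2
    simp only [Nat.cast_zero, zero_div] at this
    linarith
  exact ⟨fun ⟨_, _, hC⟩ => exists_measure_tent_le_of_weakType hp.1 hq0 ν hC,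
    fun ⟨_, _, hC⟩ => exists_weakType_of_measure_tent_le hn hα.1 hp.1 hq0 ν hC⟩
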